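/- Theorem (bound for MMax). Let $V$ be a finite set, $m\ge 2$, and let $f_1,\dots,f_m:2^V\to\mathbb R$ be normalized ($f_i(\emptyset)=0$), monotone non-decreasing and submodular. An ordered partition is a tuple $\pi=(A_1^\pi,\dots,A_m^\pi)$ of pairwise disjoint, possibly empty, sets with union $V$. An $\alpha$-approximate solution of $\max_\pi\min_i g_i(A_i^\pi)$ is an ordered partition $\pi$ with $\min_i g_i(A_i^\pi)\ge\alpha\min_i g_i(A_i^{\pi'})$ for every ordered partition $\pi'$. Submodular fair allocation (SFA) is this problem for $g_i=f_i$. For $h\in\mathbb R^V$ and $X\subseteq V$ write $h(X)=\sum_{v\in X}h(v)$. Fix $c>0$ and put $\alpha=c/(\sqrt m\log^3 m)$. Let the algorithm MMax solve its modular max-min problems within the factor $\alpha$: its first partition $\hat\pi$ is an $\alpha$-approximate solution for $g_i(X)=\sum_{v\in X}f_i(\{v\})$; given a partition $\pi^t$, it picks subgradients $h_i\in\partial_{f_i}(A_i^{\pi^t})$, where $\partial_f(Y)=\{y\in\mathbb R^V: f(X)-y(X)\ge f(Y)-y(Y)\ \text{for all } X\subseteq V\}$, and lets $\pi^{t+1}$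 be an $\alpha$-approximate solution for $g_i=h_i$. After any number of steps it returns, among all partitions computed (including $\hat\pi$), one of largest value $\min_i f_i(A_i)$. Then both the first partition $\hat\pi=(A_1^{\hat\pi},\dots,A_m^{\hat\pi})$ and the returned partition are approximate solutions of SFA with factor $$c\cdot\min_i\frac{1+(|A_i^{\hat\pi}|-1)\,(1-\kappa_{f_i}(A_i^{\hat\pi}))}{|A_i^{\hat\pi}|\,\sqrt m\,\log^3 m},$$ where, with $f(v\mid S)=f(S\cup\{v\})-f(S)$, $\kappa_f(A)=1-\min_{v\in V} f(v\mid A\setminus\{v\})/f(\{v\})$ is the curvature of $f$ at $A$. Ratios with $f(\{v\})=0$ are read as $1$, and for an empty block the quotient $\big(1+(|A_i|-1)(1-\kappa_{f_i}(A_i))\big)/|A_i|$ is read as $1$. -/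

import Mathlib

/-- An ordered partition of the finite ground set `V` into `m` blocks: the blocks are pairwise
disjoint and cover `V`.  Their order matters, and a block may be empty. -/
structure OrderedPartition (V : Type*) [Fintype V] [DecidableEq V] (m : ℕ) where
  block : Fin m → Finset V
  disjoint : ∀ i j, i ≠ j → Disjoint (block i) (block j)
  cover : ∀ v : V, ∃ i, v ∈ block i

/-- Submodularity of a set function: `f S + f T ≥ f (S ∪ T) + f (S ∩ T)`. -/
def IsSubmodular {V : Type*} [DecidableEq V] (f : Finset V → ℝ) : Prop :=
  ∀ S T : Finset V, f (S ∪ T) + f (S ∩ T) ≤ f S + f T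

/-- The gain `f (v | S) = f (S ∪ {v}) - f S`. -/
def gain {V : Type*} [DecidableEq V] (f : Finset V → ℝ) (v : V) (S : Finset V) : ℝ :=
  f (insert v S) - f S

/-- The modular set function `X ↦ ∑ v ∈ X, w v` of a weight vector. -/
def modularFun {V : Type*} (w : V → ℝ) (X : Finset V) : ℝ := ∑ v ∈ X, w v

/-- The subdifferential `∂_f(Y) = {y ∈ ℝ^V : f(X) - y(X) ≥ f(Y) - y(Y) for all X ⊆ V}`. -/
def subdifferential {V : Type*} (f : Finset V → ℝ) (Y : Finset V) : Set (V → ℝ) :=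
  {y | ∀ X : Finset V, f Y - modularFun y Y ≤ f X - modularFun y X}

/-- The curvature `κ_f(A) = 1 - min_{v ∈ V} f(v | A \ v) / f(v)`, where the ratio of an element
with `f(v) = 0` is read as `1`, so that such elements do not affect the minimum. -/
noncomputable def curvature {V : Type*} [Fintype V] [DecidableEq V]
    (f : Finset V → ℝ) (A : Finset V) : ℝ :=
  1 - ⨅ v : V, if f {v} = 0 then 1 else gain f v (A \ {v}) / f {v}

section
variable {V : Type*} [Fintype V] [DecidableEq V] {m : ℕ}

/-- The objective `min_i g_i(A_i)` of submodular fair allocation (for `m ≥ 1`). -/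
noncomputable def minValue (g : Fin m → Finset V → ℝ) (P : OrderedPartition V m) : ℝ :=
  ⨅ i, g i (P.block i)

/-- `P` is a solution of `max_Q min_i g_i(Q_i)` with approximation factor `α`: its value is at
least `α` times the value of every ordered partition. -/
def IsApproxSolution (α : ℝ) (g : Fin m → Finset V → ℝ) (P : OrderedPartition V m) : Prop :=
  ∀ Q : OrderedPartition V m, α * minValue g Q ≤ minValue g P

/-- `P 0, …, P T` are the successive partitions of a run of MMax on `f` whose modular max-min
subproblems are solved within the factor `α`.  The first one solves the subproblem with the
weights `f_i({v})`; the partition after `P t` solves the subproblem for arbitrarily picked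
subgradients `h_i` of `f_i` at the `i`-th block of `P t`.  No stopping rule is imposed, so `T` may
be any time, in particular the first `t ≥ 1` with `P t = P (t - 1)`. -/
structure IsMMaxRun (α : ℝ) (f : Fin m → Finset V → ℝ) (T : ℕ)
    (P : ℕ → OrderedPartition V m) : Prop where
  first : IsApproxSolution α (fun i => modularFun fun v => f i {v}) (P 0)
  step : ∀ t < T, ∃ h : Fin m → V → ℝ,
    (∀ i, h i ∈ subdifferential (f i) ((P t).block i)) ∧
    IsApproxSolution α (fun i => modularFun (h i)) (P (t + 1))

/-- The output of the run: a computed partition of largest objective value. -/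
def IsMMaxOutput (f : Fin m → Finset V → ℝ) (T : ℕ) (P : ℕ → OrderedPartition V m)
    (out : OrderedPartition V m) : Prop :=
  (∃ s ≤ T, out = P s) ∧ ∀ t ≤ T, minValue f (P t) ≤ minValue f out

/-- `(1 + (|A| - 1)(1 - κ_f(A))) / |A|`, with value `1` for the empty block.  As the ratio of a
nonempty block is at most `1` for the functions considered here, an empty block does not affect a
minimum over the blocks. -/
noncomputable def curvatureRatio (f : Finset V → ℝ) (A : Finset V) : ℝ :=
  if A = ∅ then 1 else (1 + ((A.card : ℝ) - 1) * (1 - curvature f A)) / (A.card : ℝ)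

/-- `min_i (1 + (|A_i| - 1)(1 - κ_{f_i}(A_i))) / (|A_i| √m log³ m)`. -/
noncomputable def mmaxFactor (f : Fin m → Finset V → ℝ) (P : OrderedPartition V m) : ℝ :=
  ⨅ i, curvatureRatio (f i) (P.block i) / (√(m : ℝ) * Real.log m ^ 3)

end

/-!
Replacing each `f i` by the modular function `X ↦ ∑ v ∈ X, f i {v}` loses only a bounded factor.
By subadditivity `f i X ≤ ∑ v ∈ X, f i {v}` for every `X` (`IsSubmodular.le_modularFun`).
Conversely, on a nonempty block `A`, start from any `v ∈ A` and add the other elements one at a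
time: by diminishing returns the gain of `u` is at least `f(u | A \ u) ≥ (1 - κ) f(u)`, so
`f A ≥ f(v) + (1 - κ) ∑ u ∈ A \ v, f(u)`.  Averaging over `v ∈ A` gives
`f A ≥ curvatureRatio f A * ∑ v ∈ A, f(v)` (`curvatureRatio_mul_modularFun_le`).

An `α`-approximate solution of the modular problem is hence an `α ρ`-approximate solution for `f`,
with `ρ` the least curvature ratio of its blocks.  The output of MMax is at least as good as its
first partition, which is among its candidates, so it inherits the bound however the subgradients
are chosen.
-/

lemma singleton_nonneg {V : Type*} {f : Finset V → ℝ} (hnorm : f ∅ = 0) (hmono : Monotone f)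
    (v : V) : 0 ≤ f {v} :=
  hnorm ▸ hmono (Finset.empty_subset {v})

lemma modularFun_singleton_nonneg {V : Type*} {f : Finset V → ℝ} (hnorm : f ∅ = 0)
    (hmono : Monotone f) (X : Finset V) : 0 ≤ modularFun (fun v => f {v}) X :=
  Finset.sum_nonneg fun v _ => singleton_nonneg hnorm hmono v

section

variable {V : Type*} [DecidableEq V] {f : Finset V → ℝ}

/-- Diminishing returns. -/
lemma IsSubmodular.gain_le_gain (hsub : IsSubmodular f) {S T : Finset V} {v : V} (hST : S ⊆ T)
    (hv : v ∉ T) : gain f v T ≤ gain f v S := by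
  have h := hsub (insert v S) T
  have hunion : insert v S ∪ T = insert v T := by
    rw [Finset.insert_union, Finset.union_eq_right.mpr hST]
  have hinter : insert v S ∩ T = S := by
    rw [Finset.insert_inter_of_notMem hv, Finset.inter_eq_left.mpr hST]
  rw [hunion, hinter] at h
  simp only [gain]
  linarith

lemma IsSubmodular.le_modularFun (hsub : IsSubmodular f) (hnorm : f ∅ = 0) (X : Finset V) :
    f X ≤ modularFun (fun v => f {v}) X := by
  induction X using Finset.induction_on with
  | empty => simp [modularFun, hnorm]
  | insert v X hv ih =>
    have h := hsub.gain_le_gain (Finset.empty_subset X) hv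
    simp only [modularFun, gain, insert_empty_eq, hnorm] at h ih ⊢
    rw [Finset.sum_insert hv]
    linarith

/-- Adding `T` to `S` inside `A` gains at least the marginal gains taken at the whole of `A`. -/
lemma IsSubmodular.add_sum_gain_le (hsub : IsSubmodular f) {A S : Finset V} (hS : S ⊆ A)
    (T : Finset V) (hT : T ⊆ A) (hST : Disjoint S T) :
    f S + ∑ u ∈ T, gain f u (A \ {u}) ≤ f (S ∪ T) := by
  induction T using Finset.induction_on with
  | empty => simp
  | insert u T hu ih =>
    rw [Finset.insert_subset_iff] at hT
    rw [Finset.disjoint_insert_right] at hST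
    have hsubset : S ∪ T ⊆ A \ {u} :=
      Finset.subset_sdiff.mpr ⟨Finset.union_subset hS hT.2, by simp [hST.1, hu]⟩
    have hgain := hsub.gain_le_gain hsubset (by simp : u ∉ A \ {u})
    have hT' := ih hT.2 hST.2
    rw [Finset.sum_insert hu, Finset.union_insert]
    simp only [gain] at hgain hT' ⊢
    linarith

lemma gain_nonneg (hmono : Monotone f) (v : V) (S : Finset V) : 0 ≤ gain f v S :=
  sub_nonneg.mpr (hmono (Finset.subset_insert v S))

variable [Fintype V]

lemma one_sub_curvature_nonneg (hnorm : f ∅ = 0) (hmono : Monotone f) (A : Finset V) :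
    0 ≤ 1 - curvature f A := by
  rw [curvature, sub_sub_cancel]
  refine Real.iInf_nonneg fun v => ?_
  split_ifs
  · exact zero_le_one
  · exact div_nonneg (gain_nonneg hmono v _) (singleton_nonneg hnorm hmono v)

lemma one_sub_curvature_mul_le_gain (hnorm : f ∅ = 0) (hmono : Monotone f) (A : Finset V) (v : V) :
    (1 - curvature f A) * f {v} ≤ gain f v (A \ {v}) := by
  by_cases hv : f {v} = 0
  · simpa [hv] using gain_nonneg hmono v _
  · have hpos := (singleton_nonneg hnorm hmono v).lt_of_ne' hv
    rw [← le_div_iff₀ hpos, curvature, sub_sub_cancel]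
    exact (ciInf_le (Set.finite_range _).bddBelow v).trans_eq (if_neg hv)

lemma curvatureRatio_nonneg (hnorm : f ∅ = 0) (hmono : Monotone f) (A : Finset V) :
    0 ≤ curvatureRatio f A := by
  unfold curvatureRatio
  split_ifs with hA
  · exact zero_le_one
  · have hcard : (1 : ℝ) ≤ A.card :=
      mod_cast Finset.card_pos.mpr (Finset.nonempty_iff_ne_empty.mpr hA)
    have := mul_nonneg (sub_nonneg.mpr hcard) (one_sub_curvature_nonneg hnorm hmono A)
    positivity

/-- The curvature bound: a submodular function is not much smaller than its modular upper bound. -/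
lemma curvatureRatio_mul_modularFun_le (hnorm : f ∅ = 0) (hmono : Monotone f)
    (hsub : IsSubmodular f) (A : Finset V) :
    curvatureRatio f A * modularFun (fun v => f {v}) A ≤ f A := by
  unfold curvatureRatio
  split_ifs with hA
  · simp [hA, modularFun, hnorm]
  have hcard : (0 : ℝ) < A.card :=
    mod_cast Finset.card_pos.mpr (Finset.nonempty_iff_ne_empty.mpr hA)
  set r := 1 - curvature f A
  set s := modularFun (fun v => f {v}) A with hs
  have key : ∀ v ∈ A, f {v} + r * (s - f {v}) ≤ f A := fun v hv => by
    have h := hsub.add_sum_gain_le (Finset.singleton_subset_iff.mpr hv) (A.erase v)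
      (Finset.erase_subset v A) (by simp)
    rw [← Finset.insert_eq, Finset.insert_erase hv] at h
    have hsum : r * ∑ u ∈ A.erase v, f {u} ≤ ∑ u ∈ A.erase v, gain f u (A \ {u}) := by
      rw [Finset.mul_sum]
      exact Finset.sum_le_sum fun u _ => one_sub_curvature_mul_le_gain hnorm hmono A u
    have hsplit : ∑ u ∈ A.erase v, f {u} = s - f {v} := by
      rw [hs, modularFun, ← Finset.add_sum_erase A _ hv, add_sub_cancel_left]
    rw [hsplit] at hsum
    linarith
  have hsum := Finset.sum_le_sum key
  have hs' : ∑ v ∈ A, f {v} = s := rfl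
  rw [Finset.sum_add_distrib, ← Finset.mul_sum, Finset.sum_sub_distrib, hs', Finset.sum_const,
    Finset.sum_const, nsmul_eq_mul, nsmul_eq_mul] at hsum
  rw [div_mul_eq_mul_div, div_le_iff₀ hcard]
  linarith

/-- Solving the problem with the weights `f i {v}` within the factor `α` solves the submodular
problem within `α` times the least curvature ratio of the blocks found. -/
lemma IsApproxSolution.of_modularFun_singleton {m : ℕ} [Nonempty (Fin m)]
    {g : Fin m → Finset V → ℝ} (hnorm : ∀ i, g i ∅ = 0) (hmono : ∀ i, Monotone (g i))
    (hsub : ∀ i, IsSubmodular (g i)) {α : ℝ} (hα : 0 ≤ α) {R : OrderedPartition V m}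
    (hR : IsApproxSolution α (fun i => modularFun fun v => g i {v}) R) :
    IsApproxSolution (α * ⨅ i, curvatureRatio (g i) (R.block i)) g R := fun Q => by
  set ρ := ⨅ i, curvatureRatio (g i) (R.block i)
  have hρ : 0 ≤ ρ := Real.iInf_nonneg fun i => curvatureRatio_nonneg (hnorm i) (hmono i) _
  have hQ : minValue g Q ≤ minValue (fun i => modularFun fun v => g i {v}) Q :=
    ciInf_mono (Set.finite_range _).bddBelow fun i => (hsub i).le_modularFun (hnorm i) _
  calc α * ρ * minValue g Q = ρ * (α * minValue g Q) := by ring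
    _ ≤ ρ * minValue (fun i => modularFun fun v => g i {v}) R :=
      mul_le_mul_of_nonneg_left ((mul_le_mul_of_nonneg_left hQ hα).trans (hR Q)) hρ
    _ ≤ minValue g R := le_ciInf fun i => by
      refine le_trans (mul_le_mul ?_ ?_ ?_ ?_)
        (curvatureRatio_mul_modularFun_le (hnorm i) (hmono i) (hsub i) (R.block i))
      · exact ciInf_le (Set.finite_range _).bddBelow i
      · exact ciInf_le
          (f := fun i => modularFun (fun v => g i {v}) (R.block i))
          (Set.finite_range _).bddBelow i
      · exact Real.iInf_nonneg fun j => modularFun_singleton_nonneg (hnorm j) (hmono j) _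
      · exact curvatureRatio_nonneg (hnorm i) (hmono i) _

end

theorem mainTheorem9 {V : Type*} [Fintype V] [DecidableEq V]
    (c : ℝ) (hc : 0 < c) (m : ℕ) (hm : 2 ≤ m)
    (f : Fin m → Finset V → ℝ)
    (hnorm : ∀ i, f i ∅ = 0) (hmono : ∀ i, Monotone (f i)) (hsub : ∀ i, IsSubmodular (f i))
    (T : ℕ) (P : ℕ → OrderedPartition V m) (out : OrderedPartition V m)
    (hrun : IsMMaxRun (c / (√(m : ℝ) * Real.log m ^ 3)) f T P)
    (hout : IsMMaxOutput f T P out) :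
    IsApproxSolution (c * mmaxFactor f (P 0)) f (P 0) ∧
      IsApproxSolution (c * mmaxFactor f (P 0)) f out := by
  have : Nonempty (Fin m) := ⟨⟨0, by omega⟩⟩
  have hD : 0 ≤ √(m : ℝ) * Real.log m ^ 3 :=
    mul_nonneg (Real.sqrt_nonneg _) (pow_nonneg (Real.log_natCast_nonneg m) 3)
  have hfactor : c * mmaxFactor f (P 0) =
      c / (√(m : ℝ) * Real.log m ^ 3) * ⨅ i, curvatureRatio (f i) ((P 0).block i) := by
    simp only [mmaxFactor, div_eq_mul_inv]
    rw [← Real.iInf_mul_of_nonneg (inv_nonneg.mpr hD)]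
    ring
  have hfirst : IsApproxSolution (c * mmaxFactor f (P 0)) f (P 0) :=
    hfactor ▸ IsApproxSolution.of_modularFun_singleton hnorm hmono hsub
      (div_nonneg hc.le hD) hrun.first
  exact ⟨hfirst, fun Q => (hfirst Q).trans (hout.2 0 (Nat.zero_le T))⟩
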